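/- Let $\Delta=\{z\in\mathbb C:|z|<1\}$ be the open unit disc and $b\Delta$ the unit circle. For a continuous function $\varphi\colon b\Delta\to\mathbb C$ without zeros let $W(\varphi)\in\mathbb Z$ denote its winding number around $0$, so that $2\pi W(\varphi)$ is the change of argument of $\varphi(z)$ as $z$ runs once around $b\Delta$ in the positive direction. Let $f\colon b\Delta\to\mathbb C$ be a continuous function which has no zero on $b\Delta$ and satisfies $W(f)=0$. Suppose that $W(Pf+1)\ge 0$ for every polynomial $P$ with complex coefficients such that $Pf+1$ has no zero on $b\Delta$. Then $f$ extends holomorphically through $\Delta$, that is, there is a continuous function $F\colon\overline\Delta\to\mathbb C$ which is holomorphic on $\Delta$ and equals $f$ on $b\Delta$. -/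

import Mathlib

/-- `IsArgumentAlong φ θ`: the function `θ` is a continuous choice of the argument of
`φ (e^{it})` for `0 ≤ t ≤ 2π`, that is, as `e^{it}` runs once around the unit circle in the
positive direction. -/
def IsArgumentAlong (φ : Circle → ℂ) (θ : ℝ → ℝ) : Prop :=
  ContinuousOn θ (Set.Icc 0 (2 * Real.pi)) ∧
    ∀ t ∈ Set.Icc 0 (2 * Real.pi),
      φ (Circle.exp t) = (‖φ (Circle.exp t)‖ : ℂ) * Complex.exp ((θ t : ℂ) * Complex.I)

/-- `HasWindingNumber φ n`: the change of argument of `φ` around the unit circle is `2πn`. -/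
def HasWindingNumber (φ : Circle → ℂ) (n : ℤ) : Prop :=
  ∃ θ : ℝ → ℝ, IsArgumentAlong φ θ ∧ θ (2 * Real.pi) - θ 0 = 2 * Real.pi * n

/-- A continuous zero-free function on the circle has a winding number around `0`. -/
theorem HasWindingNumber.exists_of_continuous {φ : Circle → ℂ} (hφ : Continuous φ)
    (h0 : ∀ z, φ z ≠ 0) : ∃ n : ℤ, HasWindingNumber φ n := by
  have hpi : (0 : ℝ) < 2 * Real.pi := by positivity
  have hn : ∀ z, (‖φ z‖ : ℂ) ≠ 0 := fun z => by simpa using h0 z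
  let u : Circle → Circle := fun z => ⟨φ z / ‖φ z‖, by
    simp [Submonoid.unitSphere, h0 z]⟩
  have hu : Continuous u :=
    Continuous.subtype_mk (hφ.div (Complex.continuous_ofReal.comp hφ.norm) hn) _
  have hue : ∀ z, φ z = (‖φ z‖ : ℂ) * (u z : ℂ) := fun z => by
    change φ z = (‖φ z‖ : ℂ) * (φ z / ‖φ z‖)
    field_simp [hn z]
  let γ : C(unitInterval, Circle) :=
    ⟨fun s => u (Circle.exp (2 * Real.pi * s)), by fun_prop⟩
  obtain ⟨e, he⟩ : ∃ e, γ 0 = Circle.exp e := ⟨_, (Circle.exp_arg (γ 0)).symm⟩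
  obtain ⟨Γ, hΓ, -⟩ := Circle.isCoveringMap_exp.exists_path_lifts γ e he
  have hΓ' : ∀ s, Circle.exp (Γ s) = u (Circle.exp (2 * Real.pi * s)) := fun s => congrFun hΓ s
  have hcl : Circle.exp (Γ 1) = Circle.exp (Γ 0) := by simp [hΓ']
  obtain ⟨n, hm⟩ := Circle.exp_eq_exp.1 hcl
  refine ⟨n, fun t => Γ (Set.projIcc 0 1 zero_le_one (t / (2 * Real.pi))), ⟨?_, ?_⟩, ?_⟩
  · exact (Γ.continuous.comp (continuous_projIcc.comp (by fun_prop))).continuousOn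
  · intro t ht
    have hmem : t / (2 * Real.pi) ∈ Set.Icc (0 : ℝ) 1 :=
      ⟨div_nonneg ht.1 hpi.le, (div_le_one hpi).2 ht.2⟩
    rw [← Circle.coe_exp, hΓ', Set.projIcc_of_mem _ hmem]
    simp only
    rw [mul_div_cancel₀ _ hpi.ne']
    exact hue _
  · beta_reduce
    rw [div_self hpi.ne', zero_div, Set.projIcc_left, Set.projIcc_right]
    change Γ 1 - Γ 0 = _
    rw [hm]
    ring

/-- The winding number of a zero-free function on the circle is unique. -/
theorem HasWindingNumber.unique {φ : Circle → ℂ} (h0 : ∀ z, φ z ≠ 0) {m n : ℤ}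
    (hm : HasWindingNumber φ m) (hn : HasWindingNumber φ n) : m = n := by
  have hpi : (0 : ℝ) < 2 * Real.pi := by positivity
  obtain ⟨θ, ⟨hθ, hθe⟩, hθm⟩ := hm
  obtain ⟨η, ⟨hη, hηe⟩, hηn⟩ := hn
  have key : ∀ t ∈ Set.Icc 0 (2 * Real.pi), Circle.exp (θ t - η t) = 1 := by
    intro t ht
    have h : (‖φ (Circle.exp t)‖ : ℂ) ≠ 0 := by simpa using h0 _
    rw [Circle.exp_sub, div_eq_one, Circle.ext_iff]
    exact mul_left_cancel₀ h ((hθe t ht).symm.trans (hηe t ht))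
  have hc := Circle.isCoveringMap_exp.constOn_of_comp (g := fun t => θ t - η t)
    isPreconnected_Icc (hθ.sub hη) (fun a ha b hb => (key a ha).trans (key b hb).symm)
    (Set.right_mem_Icc.2 hpi.le) (Set.left_mem_Icc.2 hpi.le)
  have h : 2 * Real.pi * (m : ℝ) = 2 * Real.pi * n := by linarith [hc]
  exact_mod_cast mul_left_cancel₀ hpi.ne' h

open Classical in
/-- The winding number `W(φ)` around `0` of a continuous function `φ` without zeros on the unit
circle. (It is set to `0` where there is no winding number, which does not happen for such `φ`.) -/
noncomputable def windingNumber (φ : Circle → ℂ) : ℤ :=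
  if h : ∃ n : ℤ, HasWindingNumber φ n then h.choose else 0

/-- `W(φ)` is characterized by: the change of argument of `φ` is `2πW(φ)`. -/
theorem windingNumber_eq_iff {φ : Circle → ℂ} (hφ : Continuous φ) (h0 : ∀ z, φ z ≠ 0) (n : ℤ) :
    windingNumber φ = n ↔ HasWindingNumber φ n := by
  have h := HasWindingNumber.exists_of_continuous hφ h0
  have hw : HasWindingNumber φ (windingNumber φ) := by
    rw [windingNumber, dif_pos h]
    exact h.choose_spec
  exact ⟨fun e => e ▸ hw, fun hn => hw.unique h0 hn⟩

/-- A function `f` on the unit circle extends holomorphically through the open unit disc: there is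
a continuous function on the closed disc, holomorphic on the open disc, which equals `f` on the
circle. -/
def ExtendsHolomorphically (f : Circle → ℂ) : Prop :=
  ∃ F : ℂ → ℂ, ContinuousOn F (Metric.closedBall 0 1) ∧
    DifferentiableOn ℂ F (Metric.ball 0 1) ∧ ∀ z : Circle, F z = f z

/-! Let `h = 1/f`, so `W(h) = 0`, and let `A` be the disc algebra, the uniform closure of the
polynomials in `C(Circle, ℂ)`. If `h ∈ A`, the argument principle shows that `h` has no zero in the
disc, so `f = 1/h` lies in `A` (`circleDiscAlgebra.inv_mem`) and extends. If `h ∉ A`, there is a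
polynomial `Q` with `W(h - Q) < 0` (`exists_polynomial_sub_hasWindingNumber_neg`); then `1 - Q f = f
(h - Q)` has negative winding number, against the hypothesis with `P = -Q`.

To find `Q`, approximate `h` by a trigonometric polynomial `t = z⁻ᴺ p`. By Carathéodory–Fejér
(`Polynomial.exists_caratheodory_fejer`), `p = w/v + zᴺ r/v`, where `deg w < N`, `v` is zero-free on
the closed disc and `|w/v|` is constant on the circle. With `g = r/v ∈ A`, the error `t - g = z⁻ᴺ
w/v` has constant modulus, and its winding number is at most `deg w - N < 0`. Its modulus exceeds
the error of approximating `h` by `t`, so Rouché carries the winding number over to `h - Q` for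
polynomials `Q` close to `g`. -/

open Polynomial

/-! ### Winding numbers: products, Rouché, the argument principle for polynomials. -/

namespace HasWindingNumber

variable {φ ψ : Circle → ℂ} {m n : ℤ}

theorem mul (hφ : HasWindingNumber φ m) (hψ : HasWindingNumber ψ n) :
    HasWindingNumber (fun z => φ z * ψ z) (m + n) := by
  obtain ⟨θ, ⟨hθ, hθe⟩, hθm⟩ := hφ
  obtain ⟨η, ⟨hη, hηe⟩, hηn⟩ := hψ
  refine ⟨fun t => θ t + η t, ⟨hθ.add hη, fun t ht => ?_⟩, ?_⟩
  · dsimp only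
    rw [norm_mul]
    conv_lhs => rw [hθe t ht, hηe t ht]
    push_cast
    rw [add_mul, Complex.exp_add]
    ring
  · push_cast
    linarith

theorem const {c : ℂ} : HasWindingNumber (fun _ => c) 0 :=
  ⟨fun _ => c.arg, ⟨continuousOn_const, fun _ _ => (Complex.norm_mul_exp_arg_mul_I c).symm⟩,
    by simp⟩

theorem coe : HasWindingNumber (fun z : Circle => (z : ℂ)) 1 :=
  ⟨fun t => t, ⟨continuousOn_id, fun t _ => by simp [Circle.coe_exp]⟩, by simp⟩

theorem coe_pow (k : ℕ) : HasWindingNumber (fun z : Circle => (z : ℂ) ^ k) k := by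
  induction k with
  | zero => simpa using const (c := 1)
  | succ k ih => simpa [pow_succ] using ih.mul coe

/-- The values stay in the right half-plane, where the principal argument is continuous; being a
function of the point, it returns to its initial value. -/
theorem of_norm_sub_one_lt (hφ : Continuous φ) (h : ∀ z, ‖φ z - 1‖ < 1) :
    HasWindingNumber φ 0 := by
  have hs : ∀ z, φ z ∈ Complex.slitPlane := fun z => by
    refine Complex.mem_slitPlane_iff.2 (Or.inl ?_)
    have h1 := (Complex.abs_re_le_norm (φ z - 1)).trans_lt (h z)
    have h2 := (abs_lt.1 h1).1
    simp at h2
    linarith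
  refine ⟨fun t => (φ (Circle.exp t)).arg, ⟨?_, fun t _ =>
    (Complex.norm_mul_exp_arg_mul_I _).symm⟩, by simp⟩
  refine Continuous.continuousOn (continuous_iff_continuousAt.2 fun t => ?_)
  exact ContinuousAt.comp (f := fun t => φ (Circle.exp t)) (Complex.continuousAt_arg (hs _))
    (hφ.comp Circle.exp.continuous).continuousAt

/-- Rouché's theorem for winding numbers. -/
theorem of_norm_sub_lt (hψ : HasWindingNumber ψ n) (cφ : Continuous φ) (cψ : Continuous ψ)
    (h : ∀ z, ‖φ z - ψ z‖ < ‖ψ z‖) : HasWindingNumber φ n := by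
  have h0 : ∀ z, ψ z ≠ 0 := fun z => norm_pos_iff.1 ((norm_nonneg _).trans_lt (h z))
  have h1 : HasWindingNumber (fun z => φ z / ψ z) 0 := by
    refine of_norm_sub_one_lt (cφ.div cψ h0) fun z => ?_
    rw [div_sub_one (h0 z), norm_div, div_lt_one (norm_pos_iff.2 (h0 z))]
    exact h z
  have h2 := hψ.mul h1
  rw [add_zero] at h2
  convert h2 using 2 with z
  exact (mul_div_cancel₀ _ (h0 z)).symm

theorem sub_const_of_norm_lt {a : ℂ} (ha : ‖a‖ < 1) :
    HasWindingNumber (fun z : Circle => (z : ℂ) - a) 1 :=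
  coe.of_norm_sub_lt (by fun_prop) (by fun_prop) fun z => by simpa [Circle.norm_coe z] using ha

theorem sub_const_of_lt_norm {a : ℂ} (ha : 1 < ‖a‖) :
    HasWindingNumber (fun z : Circle => (z : ℂ) - a) 0 :=
  (const (c := -a)).of_norm_sub_lt (by fun_prop) (by fun_prop) fun z => by simpa [Circle.norm_coe z] using ha

theorem multiset_prod_sub (s : Multiset ℂ) (hs : ∀ a ∈ s, ‖a‖ ≠ 1) :
    HasWindingNumber (fun z : Circle => (s.map fun a => (z : ℂ) - a).prod)
      (s.countP fun a => ‖a‖ < 1 : ℕ) := by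
  induction s using Multiset.induction with
  | empty => simpa using const (c := 1)
  | cons a s ih =>
    have h1 := ih fun b hb => hs b (Multiset.mem_cons_of_mem hb)
    rcases lt_or_gt_of_ne (hs a (Multiset.mem_cons_self a s)) with ha | ha
    · rw [Multiset.countP_cons_of_pos s (p := fun a : ℂ => ‖a‖ < 1) ha]
      convert (sub_const_of_norm_lt ha).mul h1 using 1
      · simp
      · push_cast; ring
    · rw [Multiset.countP_cons_of_neg s (p := fun a : ℂ => ‖a‖ < 1) (not_lt.2 ha.le)]
      convert (sub_const_of_lt_norm ha).mul h1 using 1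
      · simp
      · ring

/-- The argument principle for polynomials. -/
theorem polynomial_eval {p : Polynomial ℂ} (hp : ∀ z : Circle, p.eval (z : ℂ) ≠ 0) :
    HasWindingNumber (fun z : Circle => p.eval (z : ℂ)) (p.roots.countP fun a => ‖a‖ < 1 : ℕ) := by
  have h1 := multiset_prod_sub p.roots fun a ha h => by
    refine hp ⟨a, by simpa [Submonoid.unitSphere] using h⟩ ?_
    exact Polynomial.isRoot_of_mem_roots ha
  have h2 := (const (c := p.leadingCoeff)).mul h1
  rw [zero_add] at h2
  convert h2 using 2 with z
  exact (IsAlgClosed.splits p).eval_eq_prod_roots _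

end HasWindingNumber

/-! ### Multiplication modulo `X ^ N` and the Carathéodory–Fejér theorem. -/

/-- The `ℓ²` inner product of the first `N` coefficients of two polynomials. -/
noncomputable def truncInner (N : ℕ) (x y : ℂ[X]) : ℂ :=
  ∑ i ∈ Finset.range N, x.coeff i * starRingEnd ℂ (y.coeff i)

namespace truncInner

variable {N : ℕ} (x y z : ℂ[X])

theorem add_left : truncInner N (x + y) z = truncInner N x z + truncInner N y z := by
  simp [truncInner, add_mul, Finset.sum_add_distrib]

theorem C_mul_left (a : ℂ) : truncInner N (C a * x) y = a * truncInner N x y := by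
  simp [truncInner, Finset.mul_sum, mul_assoc]

theorem conj_symm : starRingEnd ℂ (truncInner N x y) = truncInner N y x := by
  simp [truncInner, mul_comm]

theorem self_eq : truncInner N x x = ((∑ i ∈ Finset.range N, ‖x.coeff i‖ ^ 2 : ℝ) : ℂ) := by
  simp [truncInner, Complex.mul_conj']

/-- Multiplication by `X` shifts the coefficients isometrically, except that the last one leaves the
truncation. -/
theorem X_mul_X_mul :
    truncInner (N + 1) (X * x) (X * y) + x.coeff N * starRingEnd ℂ (y.coeff N) =
      truncInner (N + 1) x y := by
  rw [truncInner, truncInner, Finset.sum_range_succ', Finset.sum_range_succ]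
  simp

theorem X_pow_mul_right : truncInner N x (X ^ N * y) = 0 := by
  refine Finset.sum_eq_zero fun i hi => ?_
  rw [coeff_X_pow_mul', if_neg (not_le.2 (Finset.mem_range.1 hi)), map_zero, mul_zero]

theorem congr_left {x x' : ℂ[X]} (h : ∀ i < N, x.coeff i = x'.coeff i) :
    truncInner N x y = truncInner N x' y :=
  Finset.sum_congr rfl fun i hi => by rw [h i (Finset.mem_range.1 hi)]

theorem congr_right {y y' : ℂ[X]} (h : ∀ i < N, y.coeff i = y'.coeff i) :
    truncInner N x y = truncInner N x y' :=
  Finset.sum_congr rfl fun i hi => by rw [h i (Finset.mem_range.1 hi)]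

end truncInner

theorem Polynomial.coeff_mul_congr {N : ℕ} (p : ℂ[X]) {x x' : ℂ[X]}
    (h : ∀ i < N, x.coeff i = x'.coeff i) : ∀ i < N, (p * x).coeff i = (p * x').coeff i := by
  intro i hi
  rw [coeff_mul, coeff_mul]
  refine Finset.sum_congr rfl fun k hk => ?_
  rw [h k.2 (by have := Finset.HasAntidiagonal.mem_antidiagonal.1 hk; lia)]

theorem Complex.normSq_sum_range (a : ℕ → ℂ) (N : ℕ) :
    ‖∑ i ∈ Finset.range N, a i‖ ^ 2 =
      2 * (∑ i ∈ Finset.range N, ∑ j ∈ Finset.range (i + 1), a i * starRingEnd ℂ (a j)).re -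
        ∑ i ∈ Finset.range N, ‖a i‖ ^ 2 := by
  induction N with
  | zero => simp
  | succ N ih =>
    rw [Finset.sum_range_succ, Finset.sum_range_succ _ N, Finset.sum_range_succ _ N,
      Finset.sum_range_succ _ N, ← Finset.mul_sum, ← map_sum, Complex.sq_norm, Complex.normSq_add,
      ← Complex.sq_norm, ih, Complex.mul_conj', ← Complex.sq_norm]
    have h : (a N * starRingEnd ℂ (∑ i ∈ Finset.range N, a i)).re =
        ((∑ i ∈ Finset.range N, a i) * starRingEnd ℂ (a N)).re := by
      simp only [Complex.mul_re, Complex.conj_re, Complex.conj_im]; ring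
    have h' : ((‖a N‖ : ℂ) ^ 2).re = ‖a N‖ ^ 2 := by
      rw [← Complex.ofReal_pow, Complex.ofReal_re]
    rw [Complex.add_re, Complex.add_re, h, h']
    ring

/-- The modulus of a polynomial on the unit circle in terms of the autocorrelations of its
coefficients. -/
theorem Polynomial.normSq_eval_circle {N : ℕ} {x : ℂ[X]} (hx : x.degree < N) (z : Circle) :
    ‖x.eval (z : ℂ)‖ ^ 2 =
      2 * (∑ k ∈ Finset.range N, truncInner N x (X ^ k * x) * (z : ℂ) ^ k).re -
        (truncInner N x x).re := by
  have hz : (z : ℂ) * starRingEnd ℂ (z : ℂ) = 1 := by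
    rw [Complex.mul_conj', Circle.norm_coe z]; simp
  have hx' : x.eval (z : ℂ) = ∑ i ∈ Finset.range N, x.coeff i * (z : ℂ) ^ i := by
    rcases eq_or_ne x 0 with rfl | h0
    · simp
    · exact eval_eq_sum_range' ((natDegree_lt_iff_degree_lt h0).2 hx) _
  rw [hx', Complex.normSq_sum_range, truncInner.self_eq, Complex.ofReal_re]
  congr 3
  · simp only [truncInner, Finset.sum_mul]
    rw [Finset.sum_comm]
    refine Finset.sum_congr rfl fun i hi => ?_
    -- Reindex by the lag `k = i - j`; lags `k > i` contribute zero, so `k` may run over the full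
    -- range.
    rw [← Finset.sum_flip]
    refine Finset.sum_subset_zero_on_sdiff (Finset.range_subset_range.2 (Finset.mem_range.1 hi))
      (fun k hk => ?_) fun k hk => ?_
    · rw [coeff_X_pow_mul', if_neg (by grind), map_zero, mul_zero, zero_mul]
    · have hki : k ≤ i := by grind
      rw [coeff_X_pow_mul', if_pos hki, map_mul, map_pow]
      have hp : (z : ℂ) ^ i = (z : ℂ) ^ (i - k) * (z : ℂ) ^ k := by
        rw [← pow_add, Nat.sub_add_cancel hki]
      rw [hp]
      have := congrArg (· ^ (i - k)) hz
      simp only [mul_pow, one_pow] at this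
      linear_combination x.coeff i * starRingEnd ℂ (x.coeff (i - k)) * (z : ℂ) ^ k * this
  · simp [Circle.norm_coe z]

/-- The defect `M ⟪x, y⟫ - ⟪p x, p y⟫` of multiplication by `p` modulo `X ^ N`. -/
noncomputable def truncDefect (p : ℂ[X]) (N : ℕ) (M : ℝ) (x y : ℂ[X]) : ℂ :=
  M * truncInner N x y - truncInner N (p * x) (p * y)

namespace truncDefect

variable {p : ℂ[X]} {N : ℕ} {M : ℝ} (x y z : ℂ[X])

theorem add_left :
    truncDefect p N M (x + y) z = truncDefect p N M x z + truncDefect p N M y z := by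
  simp only [truncDefect, mul_add, truncInner.add_left]; ring

theorem C_mul_left (a : ℂ) : truncDefect p N M (C a * x) y = a * truncDefect p N M x y := by
  simp only [truncDefect, mul_left_comm p, truncInner.C_mul_left]; ring

theorem conj_symm : starRingEnd ℂ (truncDefect p N M x y) = truncDefect p N M y x := by
  simp [truncDefect, truncInner.conj_symm]

theorem add_right :
    truncDefect p N M x (y + z) = truncDefect p N M x y + truncDefect p N M x z := by
  rw [← conj_symm, add_left, map_add, conj_symm, conj_symm]

theorem C_mul_right (a : ℂ) :
    truncDefect p N M x (C a * y) = starRingEnd ℂ a * truncDefect p N M x y := by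
  rw [← conj_symm, C_mul_left, map_mul, conj_symm]

theorem self_im : (truncDefect p N M x x).im = 0 :=
  Complex.conj_eq_iff_im.1 (conj_symm x x)

theorem X_pow_mul_right : truncDefect p N M x (X ^ N * y) = 0 := by
  rw [truncDefect, mul_left_comm, truncInner.X_pow_mul_right, truncInner.X_pow_mul_right,
    mul_zero, sub_zero]

/-- This is Cauchy–Schwarz for a positive semidefinite form: if `x` paired nontrivially with `y`, a
small multiple of `y` added to `x` would make the form negative. -/
theorem eq_zero_of_self (hpos : ∀ x, 0 ≤ (truncDefect p N M x x).re) {x : ℂ[X]}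
    (hx : truncDefect p N M x x = 0) (y : ℂ[X]) : truncDefect p N M x y = 0 := by
  by_contra hb
  set b := truncDefect p N M x y with hbdef
  set Q := (truncDefect p N M y y).re with hQ
  have hQ0 : 0 ≤ Q := hpos y
  have hyy : truncDefect p N M y y = Q := by
    apply Complex.ext <;> simp [hQ, self_im]
  have hyx : truncDefect p N M y x = starRingEnd ℂ b := (conj_symm x y).symm
  have hn : 0 < ‖b‖ ^ 2 := by positivity
  -- The denominator is `Q + 1` rather than the optimal `Q`, which may vanish.
  have h := hpos (x + C (-(b / (Q + 1))) * y)
  have e : truncDefect p N M (x + C (-(b / (Q + 1))) * y) (x + C (-(b / (Q + 1))) * y) =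
      ((‖b‖ ^ 2 * (-(Q + 2) / (Q + 1) ^ 2) : ℝ) : ℂ) := by
    have hQ1 : (Q + 1 : ℂ) ≠ 0 := by
      exact_mod_cast (by positivity : Q + 1 ≠ 0)
    simp only [add_left, add_right, C_mul_left, C_mul_right, hx, hyy, hyx, ← hbdef]
    push_cast
    rw [← Complex.mul_conj']
    simp only [map_neg, map_div₀, map_add, Complex.conj_ofReal, map_one]
    field_simp
    ring
  rw [e, Complex.ofReal_re] at h
  have : -(Q + 2) / (Q + 1) ^ 2 < 0 := div_neg_of_neg_of_pos (by linarith) (by positivity)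
  nlinarith

/-- Roots in the closed disc can be divided out of the null vectors of a positive semidefinite
defect form. -/
theorem eq_zero_of_X_sub_C_mul (hpos : ∀ x, 0 ≤ (truncDefect p (N + 1) M x x).re) {u : ℂ[X]}
    {a : ℂ} (ha : ‖a‖ ≤ 1) (hu : u.coeff N = 0)
    (h : truncDefect p (N + 1) M ((X - C a) * u) ((X - C a) * u) = 0) :
    truncDefect p (N + 1) M u u = 0 := by
  have hv : ∀ y, truncDefect p (N + 1) M (X * u) y = a * truncDefect p (N + 1) M u y := by
    intro y
    have h1 := eq_zero_of_self hpos h y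
    rw [show (X - C a) * u = X * u + C (-a) * u by rw [C_neg]; ring, add_left, C_mul_left] at h1
    linear_combination h1
  have hshift : ∀ y, truncDefect p (N + 1) M (X * u) (X * y) =
      truncDefect p (N + 1) M u y + (p * u).coeff N * starRingEnd ℂ ((p * y).coeff N) := by
    intro y
    have h1 := truncInner.X_mul_X_mul (N := N) u y
    have h2 := truncInner.X_mul_X_mul (N := N) (p * u) (p * y)
    rw [hu, zero_mul, add_zero] at h1
    rw [truncDefect, truncDefect, mul_left_comm p X, mul_left_comm p X, h1, ← h2]
    ring
  have hq : truncDefect p (N + 1) M u u = ((truncDefect p (N + 1) M u u).re : ℂ) := by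
    apply Complex.ext <;> simp [self_im]
  -- Writing `D` for the form, `hshift` at `y = u` reads `|a|² D(u,u) = D(u,u) + |(pu)_N|²`; since
  -- `|a| ≤ 1` and `D(u,u) ≥ 0`, the last term vanishes.
  have hc : (p * u).coeff N = 0 := by
    have h1 := hshift u
    rw [hv, ← conj_symm, hv, map_mul, conj_symm, ← mul_assoc, Complex.mul_conj',
      Complex.mul_conj', hq] at h1
    have h2 : ‖a‖ ^ 2 * (truncDefect p (N + 1) M u u).re =
        (truncDefect p (N + 1) M u u).re + ‖(p * u).coeff N‖ ^ 2 := by exact_mod_cast h1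
    have h3 : ‖a‖ ^ 2 ≤ 1 := pow_le_one₀ (norm_nonneg _) ha
    have h4 := mul_le_of_le_one_left (hpos u) h3
    exact norm_eq_zero.1 (pow_eq_zero_iff (two_ne_zero)|>.1
      (le_antisymm (by linarith) (sq_nonneg _)))
  -- The shift now preserves pairings with `u`. Iterating it `N + 1` times pushes the second
  -- argument out of the truncation, which also settles `|a| = 1`.
  have hrec : ∀ k, truncDefect p (N + 1) M u u = a ^ k * truncDefect p (N + 1) M u (X ^ k * u) := by
    intro k
    induction k with
    | zero => simp
    | succ k ih =>
      have h1 := hshift (X ^ k * u)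
      rw [hc, zero_mul, add_zero, hv, ← mul_assoc X, ← pow_succ'] at h1
      rw [ih, ← h1, pow_succ a, mul_assoc]
  rw [hrec (N + 1), X_pow_mul_right, mul_zero]

end truncDefect

-- `M` is the squared operator norm of multiplication by `p` on `ℂ[X]/(X ^ N)`, attained at `v`
-- because the unit sphere is compact; it is positive because `p` is nonzero there.
open truncDefect in
theorem truncDefect.exists_extremal {p : ℂ[X]} {N : ℕ} (hp : ¬ X ^ N ∣ p) :
    ∃ M : ℝ, 0 < M ∧ (∀ x, 0 ≤ (truncDefect p N M x x).re) ∧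
      ∃ v : ℂ[X], v ≠ 0 ∧ v.degree < N ∧ truncDefect p N M v v = 0 := by
  let S : ℂ[X] → ℝ := fun x => ∑ i ∈ Finset.range N, ‖x.coeff i‖ ^ 2
  have hSC : ∀ (c : ℂ) x, S (C c * x) = ‖c‖ ^ 2 * S x := fun c x => by
    simp [S, Finset.mul_sum, mul_pow]
  have hS0 : ∀ x, 0 ≤ S x := fun x => Finset.sum_nonneg fun i _ => by positivity
  have hSzero : ∀ x, S x = 0 ↔ X ^ N ∣ x := fun x => by
    rw [Finset.sum_eq_zero_iff_of_nonneg fun i _ => by positivity, X_pow_dvd_iff]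
    simp
  have hdef : ∀ M x, truncDefect p N M x x = ((M * S x - S (p * x) : ℝ) : ℂ) := fun M x => by
    rw [truncDefect, truncInner.self_eq, truncInner.self_eq, Complex.ofReal_sub, Complex.ofReal_mul]
  have hN : 0 < N := Nat.pos_of_ne_zero fun h => hp (by simp [h])
  let T : EuclideanSpace ℂ (Fin N) → ℂ[X] := fun a => ∑ i : Fin N, monomial i (a i)
  have hTc : ∀ (a : EuclideanSpace ℂ (Fin N)) (i : Fin N), (T a).coeff i = a i := fun a i => by
    simp [T, coeff_monomial, Fin.val_inj]
  have hTdeg : ∀ a : EuclideanSpace ℂ (Fin N), (T a).degree < N := fun a =>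
    (degree_sum_le _ _).trans_lt <| (Finset.sup_lt_iff (WithBot.bot_lt_coe N)).2 fun i _ =>
      (degree_monomial_le _ _).trans_lt (Nat.cast_lt.2 i.2)
  have hTs : ∀ (c : ℂ) (a : EuclideanSpace ℂ (Fin N)), T (c • a) = C c * T a := fun c a => by
    simp [T, Finset.mul_sum, C_mul_monomial]
  have hST : ∀ a : EuclideanSpace ℂ (Fin N), S (T a) = ‖a‖ ^ 2 := fun a => by
    rw [EuclideanSpace.norm_sq_eq, ← Finset.sum_congr rfl fun i _ => by rw [← hTc a i]]
    exact Finset.sum_range _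
  have hcont : Continuous fun a : EuclideanSpace ℂ (Fin N) => S (p * T a) := by
    refine continuous_finsetSum _ fun i _ => ?_
    simp only [T, Finset.mul_sum, finsetSum_coeff]
    refine (Continuous.norm (continuous_finsetSum _ fun j _ => ?_)).pow 2
    simp only [← C_mul_X_pow_eq_monomial, mul_left_comm p, coeff_C_mul]
    fun_prop
  have hne : (Metric.sphere (0 : EuclideanSpace ℂ (Fin N)) 1).Nonempty :=
    ⟨EuclideanSpace.single ⟨0, hN⟩ 1, by simp⟩
  obtain ⟨b, hb, hmax⟩ := (isCompact_sphere (0 : EuclideanSpace ℂ (Fin N)) 1).exists_isMaxOn hne hcont.continuousOn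
  have hb1 : ‖b‖ = 1 := by simpa using hb
  have hle : ∀ x, S (p * x) ≤ S (p * T b) * S x := by
    intro x
    let a : EuclideanSpace ℂ (Fin N) := WithLp.toLp 2 fun i => x.coeff i
    have hax : ∀ i < N, (T a).coeff i = x.coeff i := fun i hi => hTc a ⟨i, hi⟩
    have h1 : S x = ‖a‖ ^ 2 := by
      rw [← hST]
      exact Finset.sum_congr rfl fun i hi => by rw [hax i (Finset.mem_range.1 hi)]
    have h2 : S (p * x) = S (p * T a) :=
      Finset.sum_congr rfl fun i hi => by
        rw [coeff_mul_congr p hax i (Finset.mem_range.1 hi)]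
    rcases eq_or_ne a 0 with h0 | h0
    · rw [h1, h0, norm_zero, zero_pow two_ne_zero, mul_zero, (hSzero _).2]
      exact ((hSzero x).1 (by simp [h1, h0])).mul_left p
    · have hn : 0 < ‖a‖ := norm_pos_iff.2 h0
      have h3 : S (p * T (((‖a‖⁻¹ : ℝ) : ℂ) • a)) ≤ S (p * T b) :=
        hmax (by simp [norm_smul, hn.ne'])
      rw [hTs, mul_left_comm, hSC, Complex.norm_real, norm_inv, norm_norm, inv_pow,
        inv_mul_le_iff₀ (by positivity)] at h3
      rw [h1, h2]
      linarith
  have h1 := hle 1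
  rw [mul_one] at h1
  have hpp : 0 < S p := lt_of_le_of_ne (hS0 p) fun h => hp ((hSzero p).1 h.symm)
  refine ⟨S (p * T b), pos_of_mul_pos_left (hpp.trans_le h1) (hS0 1), fun x => ?_, T b, ?_,
    hTdeg b, ?_⟩
  · rw [hdef, Complex.ofReal_re]
    linarith [hle x]
  · intro h
    have := hST b
    rw [h, hb1] at this
    simp [S] at this
  · rw [hdef, hST, hb1]
    simp

/-- The Carathéodory–Fejér theorem: a polynomial `p` is congruent modulo `X ^ N` to a rational
function `w / v` of constant modulus on the unit circle, with `deg w < N`. -/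
theorem Polynomial.exists_caratheodory_fejer {p : ℂ[X]} {N : ℕ} (hp : ¬ X ^ N ∣ p) :
    ∃ (M : ℝ) (v w r : ℂ[X]), 0 < M ∧ p * v = w + X ^ N * r ∧ w.degree < N ∧
      (∀ a, ‖a‖ ≤ 1 → v.eval a ≠ 0) ∧
      ∀ z : Circle, ‖w.eval (z : ℂ)‖ ^ 2 = M * ‖v.eval (z : ℂ)‖ ^ 2 := by
  obtain ⟨M, hM, hpos, hex⟩ := truncDefect.exists_extremal hp
  let s : Set ℂ[X] := {v | v ≠ 0 ∧ v.degree < N ∧ truncDefect p N M v v = 0}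
  have hs : s.Nonempty := hex
  obtain ⟨v, ⟨hv0, hvN, hv⟩, hmin⟩ : ∃ v ∈ s, ∀ u ∈ s, v.natDegree ≤ u.natDegree :=
    ⟨_, Function.argminOn_mem natDegree s hs, fun u hu => Function.argminOn_le natDegree s hu⟩
  have hmon : (X ^ N : ℂ[X]).Monic := monic_X_pow N
  set w := (p * v) %ₘ X ^ N with hw
  have hdiv : p * v = w + X ^ N * ((p * v) /ₘ X ^ N) := (modByMonic_add_div _ _).symm
  have hwN : w.degree < N := by simpa using degree_modByMonic_lt (p * v) hmon
  have hpw : ∀ i < N, (p * v).coeff i = w.coeff i := fun i hi => by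
    rw [hdiv, coeff_add, coeff_X_pow_mul', if_neg (not_le.2 hi), add_zero]
  -- The null vector `v` pairs to zero with each of its shifts, so the autocorrelations of `w` are
  -- `M` times those of `v`. They determine the modulus on the circle.
  have hcorr : ∀ k, truncInner N w (X ^ k * w) = M * truncInner N v (X ^ k * v) := by
    intro k
    have h1 := truncDefect.eq_zero_of_self hpos hv (X ^ k * v)
    rw [truncDefect, mul_left_comm, truncInner.congr_left _ hpw,
      truncInner.congr_right _ (coeff_mul_congr (X ^ k) hpw)] at h1
    linear_combination -h1
  refine ⟨M, v, w, _, hM, hdiv, hwN, fun a ha hroot => ?_, fun z => ?_⟩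
  -- Dividing out a root in the closed disc would give a null vector of smaller degree.
  · obtain ⟨u, rfl⟩ := dvd_iff_isRoot.2 hroot
    have hu0 : u ≠ 0 := right_ne_zero_of_mul hv0
    have hdeg : ((X - C a) * u).natDegree = u.natDegree + 1 := by
      rw [natDegree_mul (X_sub_C_ne_zero a) hu0, natDegree_X_sub_C, add_comm]
    have hlt := (natDegree_lt_iff_degree_lt hv0).2 hvN
    obtain ⟨K, rfl⟩ : ∃ K, N = K + 1 := ⟨N - 1, by lia⟩
    have hq := truncDefect.eq_zero_of_X_sub_C_mul hpos ha
      (coeff_eq_zero_of_natDegree_lt (by lia)) hv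
    have := hmin u ⟨hu0, (natDegree_lt_iff_degree_lt hu0).1 (by lia), hq⟩
    lia
  · have h0 := hcorr 0
    simp only [pow_zero, one_mul] at h0
    rw [normSq_eval_circle hwN, normSq_eval_circle hvN, h0]
    simp only [hcorr, mul_assoc, ← Finset.mul_sum, Complex.re_ofReal_mul]
    ring

/-! ### The disc algebra: inverses and holomorphic extension. -/

/-- The inclusion of the unit circle into the complex plane. -/
def circleCoe : C(Circle, ℂ) := ⟨fun z : Circle => (z : ℂ), by fun_prop⟩

theorem aeval_circleCoe_apply (P : ℂ[X]) (z : Circle) :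
    aeval circleCoe P z = P.eval (z : ℂ) := by
  induction P using Polynomial.induction_on' with
  | add p q hp hq => simp [hp, hq]
  | monomial n a => 
    have h : circleCoe z = (z : ℂ) := rfl
    simp [aeval_monomial, h, Algebra.algebraMap_eq_smul_one]

/-- The disc algebra on the unit circle: the uniform limits of polynomials. -/
noncomputable def circleDiscAlgebra : Subalgebra ℂ C(Circle, ℂ) :=
  (aeval circleCoe : ℂ[X] →ₐ[ℂ] C(Circle, ℂ)).range.topologicalClosure

namespace circleDiscAlgebra

theorem isClosed : IsClosed (circleDiscAlgebra : Set C(Circle, ℂ)) :=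
  Subalgebra.isClosed_topologicalClosure _

theorem aeval_mem (P : ℂ[X]) : aeval circleCoe P ∈ circleDiscAlgebra :=
  Subalgebra.le_topologicalClosure _ ⟨P, rfl⟩

theorem exists_polynomial {g : C(Circle, ℂ)} (hg : g ∈ circleDiscAlgebra) {ε : ℝ} (hε : 0 < ε) :
    ∃ P : ℂ[X], ‖g - aeval circleCoe P‖ < ε := by
  obtain ⟨_, ⟨P, rfl⟩, hP⟩ := Metric.mem_closure_iff.1 hg ε hε
  exact ⟨P, by rw [← dist_eq_norm]; exact hP⟩

/-- The Neumann series converges inside the closed subalgebra. -/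
theorem exists_mul_one_sub {x : C(Circle, ℂ)} (hx : x ∈ circleDiscAlgebra) (h : ‖x‖ < 1) :
    ∃ y ∈ circleDiscAlgebra, y * (1 - x) = 1 := by
  refine ⟨∑' n, x ^ n, ?_, geom_series_mul_neg x h⟩
  refine isClosed.mem_of_tendsto (summable_geometric_of_norm_lt_one h).hasSum
    (Filter.Eventually.of_forall fun s => ?_)
  exact sum_mem fun n _ => pow_mem hx n

theorem exists_mul_prod_sub (s : Multiset ℂ) (hs : ∀ a ∈ s, 1 < ‖a‖) :
    ∃ y ∈ circleDiscAlgebra, ∀ z : Circle, y z * (s.map fun a => (z : ℂ) - a).prod = 1 := by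
  induction s using Multiset.induction with
  | empty => exact ⟨1, one_mem _, fun z => by simp⟩
  | cons a s ih =>
    obtain ⟨y, hy, hy1⟩ := ih fun b hb => hs b (Multiset.mem_cons_of_mem hb)
    have ha := hs a (Multiset.mem_cons_self a s)
    have ha0 : a ≠ 0 := norm_pos_iff.1 (zero_lt_one.trans ha)
    obtain ⟨x, hx, hx1⟩ := exists_mul_one_sub (aeval_mem (C a⁻¹ * X)) <| by
      refine (ContinuousMap.norm_lt_iff _ zero_lt_one).2 fun z => ?_
      rw [aeval_circleCoe_apply]
      simpa [Circle.norm_coe z] using inv_lt_one_of_one_lt₀ ha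
    refine ⟨(-a⁻¹) • x * y, mul_mem (Subalgebra.smul_mem _ hx _) hy, fun z => ?_⟩
    have h1 := DFunLike.congr_fun hx1 z
    simp only [ContinuousMap.mul_apply, ContinuousMap.sub_apply, aeval_circleCoe_apply,
      ContinuousMap.one_apply, eval_mul, eval_C, eval_X] at h1
    rw [Multiset.map_cons, Multiset.prod_cons]
    simp only [ContinuousMap.mul_apply, ContinuousMap.smul_apply, smul_eq_mul]
    have h2 : -a⁻¹ * ((z : ℂ) - a) = 1 - a⁻¹ * z := by field_simp; ring
    linear_combination (x z * (1 - a⁻¹ * z)) * hy1 z + h1 +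
      x z * y z * (s.map fun a => (z : ℂ) - a).prod * h2

/-- A polynomial without zeros on the closed unit disc is invertible in the disc algebra. -/
theorem exists_mul_eval {v : ℂ[X]} (hv : ∀ a, ‖a‖ ≤ 1 → v.eval a ≠ 0) :
    ∃ y ∈ circleDiscAlgebra, ∀ z : Circle, y z * v.eval (z : ℂ) = 1 := by
  obtain ⟨y, hy, hy1⟩ := exists_mul_prod_sub v.roots fun a ha =>
    not_le.1 fun h => hv a h (isRoot_of_mem_roots ha)
  have hl : v.leadingCoeff ≠ 0 := leadingCoeff_ne_zero.2 fun h => hv 0 (by simp) (by simp [h])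
  refine ⟨v.leadingCoeff⁻¹ • y, Subalgebra.smul_mem _ hy _, fun z => ?_⟩
  rw [(IsAlgClosed.splits v).eval_eq_prod_roots]
  simp only [ContinuousMap.smul_apply, smul_eq_mul]
  rw [mul_mul_mul_comm, inv_mul_cancel₀ hl, one_mul, hy1]

theorem extendsHolomorphically {f : C(Circle, ℂ)} (hf : f ∈ circleDiscAlgebra) :
    ExtendsHolomorphically f := by
  choose P hP using fun n : ℕ => exists_polynomial hf (Nat.one_div_pos_of_nat (α := ℝ) (n := n))
  have hPz : ∀ n (z : Circle), ‖f z - (P n).eval (z : ℂ)‖ < 1 / (n + 1) := fun n z => by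
    have := (ContinuousMap.norm_coe_le_norm _ z).trans_lt (hP n)
    rwa [ContinuousMap.sub_apply, aeval_circleCoe_apply] at this
  -- The maximum principle carries the estimate from the circle to the closed disc.
  have hmax : ∀ m n, ∀ z ∈ Metric.closedBall (0 : ℂ) 1,
      ‖(P m).eval z - (P n).eval z‖ ≤ 1 / (m + 1) + 1 / (n + 1) := by
    intro m n z hz
    rw [← closure_ball (0 : ℂ) one_ne_zero] at hz
    rw [← eval_sub]
    refine Complex.norm_le_of_forall_mem_frontier_norm_le (f := fun z => (P m - P n).eval z)
      Metric.isBounded_ball (P m - P n).differentiable.diffContOnCl (fun w hw => ?_) hz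
    rw [frontier_ball (0 : ℂ) one_ne_zero, mem_sphere_zero_iff_norm] at hw
    let ζ : Circle := ⟨w, by simpa [Submonoid.unitSphere] using hw⟩
    calc ‖(P m - P n).eval w‖ = ‖(f ζ - (P n).eval w) - (f ζ - (P m).eval w)‖ := by
          rw [eval_sub]; congr 1; ring
      _ ≤ ‖f ζ - (P n).eval w‖ + ‖f ζ - (P m).eval w‖ := norm_sub_le _ _
      _ ≤ _ := by rw [add_comm]; exact add_le_add (hPz m ζ).le (hPz n ζ).le
  have hcauchy : UniformCauchySeqOn (fun n z => (P n).eval z) Filter.atTop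
      (Metric.closedBall (0 : ℂ) 1) := by
    rw [Metric.uniformCauchySeqOn_iff]
    intro ε hε
    obtain ⟨K, hK⟩ := exists_nat_one_div_lt (half_pos hε)
    refine ⟨K, fun m hm n hn z hz => ?_⟩
    rw [dist_eq_norm]
    have h1 := Nat.one_div_le_one_div (α := ℝ) hm
    have h2 := Nat.one_div_le_one_div (α := ℝ) hn
    linarith [hmax m n z hz]
  have hlim : ∀ z ∈ Metric.closedBall (0 : ℂ) 1, ∃ l,
      Filter.Tendsto (fun n => (P n).eval z) Filter.atTop (nhds l) := fun z hz =>
    cauchySeq_tendsto_of_complete (hcauchy.cauchySeq hz)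
  choose! F hF using hlim
  have hunif := hcauchy.tendstoUniformlyOn_of_tendsto hF
  refine ⟨F, hunif.continuousOn (Filter.Frequently.of_forall fun n => (P n).continuousOn),
    ((hunif.mono Metric.ball_subset_closedBall).tendstoLocallyUniformlyOn).differentiableOn
      (Filter.Eventually.of_forall fun n => (P n).differentiableOn) Metric.isOpen_ball,
    fun z => tendsto_nhds_unique (hF z (by simp [Circle.norm_coe z])) ?_⟩
  rw [tendsto_iff_norm_sub_tendsto_zero]
  refine squeeze_zero (fun _ => norm_nonneg _) (fun n => ?_) tendsto_one_div_add_atTop_nhds_zero_nat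
  rw [norm_sub_rev]
  exact (hPz n z).le

/-- The inverse of a zero-free function in the disc algebra of winding number zero lies in the
disc algebra. -/
theorem inv_mem {f h : C(Circle, ℂ)} (hh : h ∈ circleDiscAlgebra) (hfh : ∀ z, f z * h z = 1)
    (hW : HasWindingNumber h 0) : f ∈ circleDiscAlgebra := by
  have hfh' : f * h = 1 := ContinuousMap.ext hfh
  have hf0 : 0 < ‖f‖ := norm_pos_iff.2 fun h0 => by simp [h0] at hfh'
  -- The factor `1/2` gives `|P - h| < |h|/2 < |P|` on the circle: the bound by `|h|` serves Rouché,
  -- the bound by `|P|` makes `h / P` a perturbation of `1`.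
  obtain ⟨P, hP⟩ := exists_polynomial hh (mul_pos (inv_pos.2 hf0) one_half_pos)
  have hP' : ‖(1 : C(Circle, ℂ)) - f * aeval circleCoe P‖ < 1 / 2 := by
    rw [← hfh', ← mul_sub]
    refine (norm_mul_le _ _).trans_lt ?_
    rwa [← lt_inv_mul_iff₀ hf0]
  have hhalf : ∀ z : Circle, ‖P.eval (z : ℂ) - h z‖ < 1 / 2 * ‖h z‖ := fun z => by
    have h1 := (ContinuousMap.norm_coe_le_norm _ z).trans_lt hP'
    simp only [ContinuousMap.sub_apply, ContinuousMap.mul_apply, ContinuousMap.one_apply,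
      aeval_circleCoe_apply] at h1
    have h2 : P.eval (z : ℂ) - h z = -((1 - f z * P.eval (z : ℂ)) * h z) := by
      linear_combination -P.eval (z : ℂ) * hfh z
    have h3 : 0 < ‖h z‖ := norm_pos_iff.2 (right_ne_zero_of_mul_eq_one (hfh z))
    rw [h2, norm_neg, norm_mul]
    exact mul_lt_mul_of_pos_right h1 h3
  have hlt : ∀ z : Circle, ‖P.eval (z : ℂ) - h z‖ < ‖h z‖ := fun z => by
    linarith [hhalf z, norm_nonneg (h z)]
  have hP0 : ∀ z : Circle, P.eval (z : ℂ) ≠ 0 := fun z h0 => by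
    have := hlt z
    rw [h0, zero_sub, norm_neg] at this
    exact this.false
  have hWP := hW.of_norm_sub_lt (φ := fun z : Circle => P.eval (z : ℂ)) (by fun_prop)
    h.continuous hlt
  have hcount := HasWindingNumber.unique hP0 (HasWindingNumber.polynomial_eval hP0) hWP
  have hdisc : ∀ a, ‖a‖ ≤ 1 → P.eval a ≠ 0 := by
    intro a ha h0
    rcases ha.lt_or_eq with ha | ha
    · have hPne : P ≠ 0 := fun h => hP0 1 (by simp [h])
      have := Multiset.countP_eq_zero.1 (Int.natCast_eq_zero.1 hcount) a
        ((mem_roots hPne).2 h0)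
      exact this ha
    · exact hP0 ⟨a, by simpa [Submonoid.unitSphere] using ha⟩ h0
  obtain ⟨y, hy, hy1⟩ := exists_mul_eval hdisc
  have hhy : ‖1 - h * y‖ < 1 := (ContinuousMap.norm_lt_iff _ zero_lt_one).2 fun z => by
    have h1 : (1 - h * y) z = (P.eval (z : ℂ) - h z) * y z := by
      simp only [ContinuousMap.sub_apply, ContinuousMap.mul_apply, ContinuousMap.one_apply]
      linear_combination -hy1 z
    have h2 : ‖y z‖ * ‖P.eval (z : ℂ)‖ = 1 := by rw [← norm_mul, hy1, norm_one]
    have h3 : 0 < ‖y z‖ := norm_pos_iff.2 (left_ne_zero_of_mul_eq_one (hy1 z))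
    have h4 : ‖P.eval (z : ℂ) - h z‖ < ‖P.eval (z : ℂ)‖ := by
      have := norm_sub_norm_le (h z) (P.eval (z : ℂ))
      rw [norm_sub_rev] at this
      linarith [hhalf z]
    rw [h1, norm_mul, ← h2, mul_comm]
    exact mul_lt_mul_of_pos_left h4 h3
  obtain ⟨k, hk, hk1⟩ := exists_mul_one_sub (sub_mem (one_mem _) (mul_mem hh hy)) hhy
  have hf : f = k * y := by linear_combination -f * hk1 + k * y * hfh'
  exact hf ▸ mul_mem hk hy

end circleDiscAlgebra

/-! ### Trigonometric approximation and translates of negative winding number. -/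

/-- Multiplied by a power of the coordinate, the conjugate of a polynomial is a polynomial on the
unit circle. -/
theorem Polynomial.exists_pow_mul_conj_eval (p : ℂ[X]) : ∃ (n : ℕ) (q : ℂ[X]), ∀ z : Circle,
    (z : ℂ) ^ n * starRingEnd ℂ (p.eval (z : ℂ)) = q.eval (z : ℂ) := by
  induction p using Polynomial.induction_on' with
  | add p q hp hq =>
    obtain ⟨m, r, hr⟩ := hp
    obtain ⟨n, s, hs⟩ := hq
    refine ⟨m + n, X ^ n * r + X ^ m * s, fun z => ?_⟩
    simp only [eval_add, eval_mul, eval_pow, eval_X, map_add, ← hr, ← hs]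
    ring
  | monomial n a =>
    refine ⟨n, C (starRingEnd ℂ a), fun z => ?_⟩
    have hz : (z : ℂ) * starRingEnd ℂ (z : ℂ) = 1 := by
      rw [Complex.mul_conj', Circle.norm_coe z]; simp
    rw [eval_monomial, eval_C, map_mul, map_pow, mul_left_comm, ← mul_pow, hz, one_pow, mul_one]

/-- The trigonometric polynomials. -/
def circleTrigPolynomials : StarSubalgebra ℂ C(Circle, ℂ) where
  carrier := {t | ∃ (n : ℕ) (p : ℂ[X]), ∀ z : Circle, (z : ℂ) ^ n * t z = p.eval (z : ℂ)}
  mul_mem' := by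
    rintro s t ⟨m, p, hp⟩ ⟨n, q, hq⟩
    refine ⟨m + n, p * q, fun z => ?_⟩
    rw [eval_mul, ← hp, ← hq, ContinuousMap.mul_apply]
    ring
  add_mem' := by
    rintro s t ⟨m, p, hp⟩ ⟨n, q, hq⟩
    refine ⟨m + n, X ^ n * p + X ^ m * q, fun z => ?_⟩
    simp only [eval_add, eval_mul, eval_pow, eval_X, ← hp, ← hq, ContinuousMap.add_apply]
    ring
  algebraMap_mem' a := ⟨0, C a, fun z => by simp [Algebra.algebraMap_eq_smul_one]⟩
  star_mem' := by
    rintro t ⟨n, p, hp⟩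
    obtain ⟨m, q, hq⟩ := p.exists_pow_mul_conj_eval
    have hz : ∀ z : Circle, (z : ℂ) * starRingEnd ℂ (z : ℂ) = 1 := fun z => by
      rw [Complex.mul_conj', Circle.norm_coe z]; simp
    refine ⟨m, X ^ n * q, fun z => ?_⟩
    have h1 := congrArg (· ^ n) (hz z)
    simp only [mul_pow, one_pow] at h1
    rw [eval_mul, eval_pow, eval_X, ← hq, ← hp, map_mul, map_pow, ContinuousMap.star_apply,
      Complex.star_def]
    linear_combination -(z : ℂ) ^ m * starRingEnd ℂ (t z) * h1

theorem circleTrigPolynomials.topologicalClosure_eq_top :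
    circleTrigPolynomials.topologicalClosure = ⊤ := by
  refine ContinuousMap.starSubalgebra_topologicalClosure_eq_top_of_separatesPoints _ ?_
  intro x y hxy
  exact ⟨_, ⟨circleCoe, ⟨0, X, fun z => by rw [pow_zero, one_mul, eval_X]; rfl⟩, rfl⟩, fun h => hxy (Circle.ext h)⟩

/-- A continuous function on the circle which is not in the disc algebra has a polynomial
translate without zeros and of negative winding number. -/
theorem exists_polynomial_sub_hasWindingNumber_neg {h : C(Circle, ℂ)}
    (hh : h ∉ circleDiscAlgebra) : ∃ (Q : ℂ[X]) (n : ℤ), n < 0 ∧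
      (∀ z : Circle, h z - Q.eval (z : ℂ) ≠ 0) ∧
      HasWindingNumber (fun z : Circle => h z - Q.eval (z : ℂ)) n := by
  obtain ⟨d, hd, hball⟩ := Metric.isOpen_iff.1 circleDiscAlgebra.isClosed.isOpen_compl h hh
  have hdist : ∀ g ∈ circleDiscAlgebra, d ≤ ‖h - g‖ := fun g hg => not_lt.1 fun hlt =>
    hball (by rwa [Metric.mem_ball, dist_comm, dist_eq_norm]) hg
  have hcl : h ∈ closure (circleTrigPolynomials : Set C(Circle, ℂ)) := by
    rw [← StarSubalgebra.topologicalClosure_coe,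
      circleTrigPolynomials.topologicalClosure_eq_top]
    trivial
  obtain ⟨t, ⟨N, p, hp⟩, ht⟩ := Metric.mem_closure_iff.1 hcl (d / 2) (half_pos hd)
  rw [dist_eq_norm] at ht
  -- If `X ^ N` divided `p`, then `t` would be a polynomial closer to `h` than `d`.
  have hz0 : ∀ z : Circle, (z : ℂ) ≠ 0 := fun z => Circle.coe_ne_zero z
  have hpN : ¬ X ^ N ∣ p := by
    rintro ⟨r, rfl⟩
    have : t = aeval circleCoe r := ContinuousMap.ext fun z => by
      rw [aeval_circleCoe_apply]
      refine mul_left_cancel₀ (pow_ne_zero N (hz0 z)) ?_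
      rw [hp, eval_mul, eval_pow, eval_X]
    have := hdist t (this ▸ circleDiscAlgebra.aeval_mem r)
    linarith
  obtain ⟨M, v, w, r, hM, hpv, hwN, hv, hwv⟩ := exists_caratheodory_fejer hpN
  obtain ⟨y, hy, hy1⟩ := circleDiscAlgebra.exists_mul_eval hv
  have hvz : ∀ z : Circle, v.eval (z : ℂ) ≠ 0 := fun z => hv _ (Circle.norm_coe z).le
  have hwz : ∀ z : Circle, w.eval (z : ℂ) ≠ 0 := fun z h0 => by
    have := hwv z
    rw [h0, norm_zero, zero_pow two_ne_zero] at this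
    have : 0 < M * ‖v.eval (z : ℂ)‖ ^ 2 := mul_pos hM (pow_pos (norm_pos_iff.2 (hvz z)) 2)
    linarith
  set g := aeval circleCoe r * y with hg
  have hgA : g ∈ circleDiscAlgebra := mul_mem (circleDiscAlgebra.aeval_mem r) hy
  have hprod : ∀ z : Circle, v.eval (z : ℂ) * (z : ℂ) ^ N * (t z - g z) = w.eval (z : ℂ) := by
    intro z
    have h1 := congrArg (eval (z : ℂ)) hpv
    simp only [eval_mul, eval_add, eval_pow, eval_X] at h1
    rw [hg, ContinuousMap.mul_apply, aeval_circleCoe_apply]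
    linear_combination v.eval (z : ℂ) * hp z + h1 - (z : ℂ) ^ N * r.eval (z : ℂ) * hy1 z
  have hnorm : ∀ z, ‖t z - g z‖ = √M := fun z => by
    have h1 := congrArg (‖·‖ ^ 2) (hprod z)
    simp only [norm_mul, norm_pow, Circle.norm_coe z, one_pow, mul_one, mul_pow, hwv] at h1
    rw [mul_comm M] at h1
    have h2 := mul_left_cancel₀ (pow_ne_zero 2 (norm_ne_zero_iff.2 (hvz z))) h1
    rw [← h2, Real.sqrt_sq (norm_nonneg _)]
  have htg0 : ∀ z, t z - g z ≠ 0 := fun z =>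
    norm_pos_iff.1 (by rw [hnorm]; exact Real.sqrt_pos.2 hM)
  -- Since `g ∈ A`, `d ≤ ‖h - g‖ ≤ ‖h - t‖ + √M`, and `‖h - t‖ < d / 2`. The gap `√M - ‖h - t‖` is
  -- the room left for replacing `g` by `Q`.
  have hMd : d / 2 < √M := by
    have h1 := hdist g hgA
    have h2 := norm_add_le (h - t) (t - g)
    rw [sub_add_sub_cancel] at h2
    have h3 : ‖t - g‖ ≤ √M :=
      (ContinuousMap.norm_le _ (Real.sqrt_nonneg _)).2 fun z => (hnorm z).le
    linarith
  obtain ⟨Q, hQ⟩ := circleDiscAlgebra.exists_polynomial hgA (sub_pos.2 (ht.trans hMd))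
  have hlt : ∀ z : Circle, ‖(h z - Q.eval (z : ℂ)) - (t z - g z)‖ < ‖t z - g z‖ := fun z => by
    have h1 := ContinuousMap.norm_coe_le_norm (h - t) z
    have h2 := ContinuousMap.norm_coe_le_norm (g - aeval circleCoe Q) z
    rw [ContinuousMap.sub_apply] at h1 h2
    rw [aeval_circleCoe_apply] at h2
    have h3 := norm_add_le (h z - t z) (g z - Q.eval (z : ℂ))
    rw [hnorm, show (h z - Q.eval (z : ℂ)) - (t z - g z) =
      (h z - t z) + (g z - Q.eval (z : ℂ)) by ring]
    linarith
  obtain ⟨n, hn⟩ := HasWindingNumber.exists_of_continuous (t - g).continuous htg0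
  have hvroots : v.roots.countP (fun a => ‖a‖ < 1) = 0 := Multiset.countP_eq_zero.2
    fun a ha hlt => hv a hlt.le (isRoot_of_mem_roots ha)
  have hWv := HasWindingNumber.polynomial_eval hvz
  rw [hvroots] at hWv
  have hWw := (hWv.mul (.coe_pow N)).mul hn
  have hWw' := HasWindingNumber.polynomial_eval hwz
  simp only [ContinuousMap.sub_apply, hprod] at hWw
  have heq := HasWindingNumber.unique hwz hWw hWw'
  -- In `heq`, `N + n` is the number of zeros of `w` in the disc, so `deg w < N` forces `n < 0`.
  have hcard : w.roots.countP (fun a => ‖a‖ < 1) < N := by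
    have hw0 : w ≠ 0 := fun h0 => hwz 1 (by simp [h0])
    exact (Multiset.countP_le_card _ _).trans_lt
      ((card_roots' w).trans_lt ((natDegree_lt_iff_degree_lt hw0).2 hwN))
  refine ⟨Q, n, by push_cast at heq; lia, fun z h0 => ?_,
    hn.of_norm_sub_lt (by fun_prop) (t - g).continuous hlt⟩
  have := hlt z
  rw [h0, zero_sub, norm_neg] at this
  exact this.false

theorem proposition2p1 (f : Circle → ℂ) (hf : Continuous f) (hf0 : ∀ z, f z ≠ 0)
    (hW : windingNumber f = 0)
    (hP : ∀ P : Polynomial ℂ, (∀ z : Circle, P.eval (z : ℂ) * f z + 1 ≠ 0) →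
      0 ≤ windingNumber (fun z : Circle => P.eval (z : ℂ) * f z + 1)) :
    ExtendsHolomorphically f := by
  have hWf := (windingNumber_eq_iff hf hf0 0).1 hW
  let h : C(Circle, ℂ) := ⟨fun z => (f z)⁻¹, hf.inv₀ hf0⟩
  have hfh : ∀ z, f z * h z = 1 := fun z => mul_inv_cancel₀ (hf0 z)
  by_cases hh : h ∈ circleDiscAlgebra
  · refine circleDiscAlgebra.extendsHolomorphically (f := ⟨f, hf⟩)
      (circleDiscAlgebra.inv_mem hh hfh ?_)
    have hh0 : ∀ z, h z ≠ 0 := fun z => inv_ne_zero (hf0 z)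
    obtain ⟨n, hn⟩ := HasWindingNumber.exists_of_continuous h.continuous hh0
    have h1 := hWf.mul hn
    simp only [hfh, zero_add] at h1
    rwa [← HasWindingNumber.unique (fun _ => one_ne_zero) h1 .const]
  · exfalso
    obtain ⟨Q, n, hn, hQ0, hQn⟩ := exists_polynomial_sub_hasWindingNumber_neg hh
    have hmul : ∀ z : Circle, (-Q).eval (z : ℂ) * f z + 1 = f z * (h z - Q.eval (z : ℂ)) :=
      fun z => by
        rw [eval_neg]
        linear_combination -hfh z
    have hne : ∀ z : Circle, (-Q).eval (z : ℂ) * f z + 1 ≠ 0 := fun z => by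
      rw [hmul]
      exact mul_ne_zero (hf0 z) (hQ0 z)
    have h1 := hP (-Q) hne
    have h2 := hWf.mul hQn
    simp only [← hmul, zero_add] at h2
    rw [(windingNumber_eq_iff (by fun_prop) hne n).2 h2] at h1
    lia
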